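/- All spaces, maps and homotopies are pointed. A group-like space is a space $X$ with a multiplication $X\times X\to X$ and an inversion $X\to X$ satisfying the group axioms up to homotopy, the base point being the unit. Its commutator map is $\gamma:X\times X\to X$, $\gamma(x,y)=xyx^{-1}y^{-1}$, and $\gamma_n:X^{n+1}\to X$ is given by $\gamma_1=\gamma$ and $\gamma_{n+1}=\gamma\circ(1\times\gamma_n)$. The homotopy nilpotency class $\mathbf{nil}\,X$ is the least integer $n\ge 1$ such that $\gamma_n$ is null homotopic, and $\infty$ if there is none (so $\mathbf{nil}\,X=1$ if and only if $X$ is homotopy commutative). Let $\bar\gamma:X\wedge X\to X$ be the reduced commutator map, i.e. a map whose composite with the pinching map $X\times X\to X\wedge X$ is homotopic to $\gamma$. The Samelson product of $\alpha:A\to X$ and $\beta:B\to X$ is $\langle\alpha,\beta\rangle=\bar\gamma\circ(\alpha\wedge\beta):A\wedge B\to X$. For a map $\alpha:A\to X$, $\alpha^{+1}=\alpha$ and $\alpha^{-1}$ is $\alpha$ followed by the inversion of $X$. **Proposition.** Let $X$ be a group-like CW-complex together with a product decomposition $X\simeq X_1\times\cdots\times X_l$, and let $\epsilon_k:X_k\to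 X$ and $\pi_k:X\to X_k$ denote the corresponding inclusions and projections. Suppose that the decomposition is compatible with the multiplication in the sense that $$1_X\simeq(\epsilon_1\circ\pi_1)\cdots(\epsilon_l\circ\pi_l),$$ where the right hand side is the pointwise product. Let $k\ge 1$. If $$(\epsilon_{i_1}\circ\pi_{i_1})^{\pm1}\circ\langle\epsilon_{j_1}^{\pm1},(\epsilon_{i_2}\circ\pi_{i_2})^{\pm1}\circ\langle\cdots(\epsilon_{i_k}\circ\pi_{i_k})^{\pm1}\circ\langle\epsilon_{j_k}^{\pm1},\epsilon_{j_{k+1}}^{\pm1}\rangle\cdots\rangle\rangle$$ is null homotopic for all $1\le i_1,\ldots,i_k,j_1,\ldots,j_{k+1}\le l$ and all choices of the signs, then $\mathbf{nil}\,X\le k$. -/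

import Mathlib

universe u v w

/-- A pointed topological space. -/
structure PtdSpace where
  carrier : Type u
  [top : TopologicalSpace carrier]
  pt : carrier

attribute [instance] PtdSpace.top

/-- A continuous map of pointed spaces preserving the base point. -/
structure PtdMap (A : PtdSpace.{u}) (B : PtdSpace.{v}) where
  toFun : C(A.carrier, B.carrier)
  map_pt : toFun A.pt = B.pt

namespace PtdMap

/-- The identity map. -/
def id (A : PtdSpace.{u}) : PtdMap A A := ⟨ContinuousMap.id _, rfl⟩

/-- The constant map at the base point. -/
def const (A : PtdSpace.{u}) (B : PtdSpace.{v}) : PtdMap A B :=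
  ⟨ContinuousMap.const _ B.pt, rfl⟩

/-- Composition `g ∘ f`. -/
def comp {A : PtdSpace.{u}} {B : PtdSpace.{v}} {C : PtdSpace.{w}}
    (g : PtdMap B C) (f : PtdMap A B) : PtdMap A C :=
  ⟨g.toFun.comp f.toFun, by simp [f.map_pt, g.map_pt]⟩

/-- Pointed homotopy: homotopy relative to the base point. -/
def Homotopic {A : PtdSpace.{u}} {B : PtdSpace.{v}} (f g : PtdMap A B) : Prop :=
  f.toFun.HomotopicRel g.toFun {A.pt}

/-- `f` is null homotopic, i.e. `f = 0` in the pointed homotopy set `[A, B]`. -/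
def IsNull {A : PtdSpace.{u}} {B : PtdSpace.{v}} (f : PtdMap A B) : Prop :=
  f.Homotopic (const A B)

end PtdMap

namespace PtdSpace

/-- The product of two pointed spaces. -/
def prod (A : PtdSpace.{u}) (B : PtdSpace.{v}) : PtdSpace.{max u v} :=
  ⟨A.carrier × B.carrier, (A.pt, B.pt)⟩

/-- The product of a finite family of pointed spaces. -/
def pi {l : ℕ} (Y : Fin l → PtdSpace.{u}) : PtdSpace.{u} :=
  ⟨∀ k, (Y k).carrier, fun k => (Y k).pt⟩

/-- The `n`-fold power `X × ⋯ × X`. -/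
def pow (X : PtdSpace.{u}) (n : ℕ) : PtdSpace.{u} := pi fun _ : Fin n => X

/-- The equivalence relation on `A × B` collapsing the wedge `A ∨ B = A × {*} ∪ {*} × B`
to one point. -/
def smashSetoid (A : PtdSpace.{u}) (B : PtdSpace.{v}) : Setoid (A.carrier × B.carrier) where
  r p q := p = q ∨ ((p.1 = A.pt ∨ p.2 = B.pt) ∧ (q.1 = A.pt ∨ q.2 = B.pt))
  iseqv :=
    { refl := fun _ => Or.inl rfl
      symm := by rintro p q (rfl | ⟨h, h'⟩) <;> tauto
      trans := by
        rintro p q r (rfl | ⟨h, h'⟩) (rfl | ⟨h₂, h₂'⟩) <;> tauto }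

/-- The smash product `A ∧ B`, the quotient space of `A × B` by `A ∨ B`. -/
def smash (A : PtdSpace.{u}) (B : PtdSpace.{v}) : PtdSpace.{max u v} where
  carrier := Quotient (smashSetoid A B)
  pt := Quotient.mk _ (A.pt, B.pt)

end PtdSpace

namespace PtdMap

/-- The pinching map `A × B → A ∧ B`. -/
def pinch (A : PtdSpace.{u}) (B : PtdSpace.{v}) : PtdMap (A.prod B) (A.smash B) :=
  ⟨⟨Quotient.mk _, continuous_quotient_mk'⟩, rfl⟩

/-- The map `(f, g) : A → B × C`. -/
def pair {A : PtdSpace.{u}} {B : PtdSpace.{v}} {C : PtdSpace.{w}}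
    (f : PtdMap A B) (g : PtdMap A C) : PtdMap A (B.prod C) :=
  ⟨f.toFun.prodMk g.toFun, Prod.ext f.map_pt g.map_pt⟩

/-- The first projection `A × B → A`. -/
def fst (A : PtdSpace.{u}) (B : PtdSpace.{v}) : PtdMap (A.prod B) A :=
  ⟨ContinuousMap.fst, rfl⟩

/-- The second projection `A × B → B`. -/
def snd (A : PtdSpace.{u}) (B : PtdSpace.{v}) : PtdMap (A.prod B) B :=
  ⟨ContinuousMap.snd, rfl⟩

/-- The map `α ∧ β : A ∧ B → A' ∧ B'` induced by `α × β`. -/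
def smashMap {A : PtdSpace.{u}} {B : PtdSpace.{v}} {A' B' : PtdSpace.{w}}
    (α : PtdMap A A') (β : PtdMap B B') : PtdMap (A.smash B) (A'.smash B') where
  toFun :=
    { toFun := Quotient.map (fun p => (α.toFun p.1, β.toFun p.2)) (by
        rintro p q (rfl | ⟨h, h'⟩)
        · exact Or.inl rfl
        · refine Or.inr ⟨?_, ?_⟩
          · rcases h with h | h
            · left; simp [h, α.map_pt]
            · right; simp [h, β.map_pt]
          · rcases h' with h | h
            · left; simp [h, α.map_pt]
            · right; simp [h, β.map_pt])
      continuous_toFun := by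
        refine Continuous.quotient_map' ?_ _
        exact (α.toFun.continuous.comp continuous_fst).prodMk
          (β.toFun.continuous.comp continuous_snd) }
  map_pt := congrArg (Quotient.mk _) (Prod.ext α.map_pt β.map_pt)

/-- The `k`-th coordinate projection `∏ Y → Y k`. -/
def proj {l : ℕ} (Y : Fin l → PtdSpace.{u}) (k : Fin l) : PtdMap (PtdSpace.pi Y) (Y k) :=
  ⟨⟨fun x => x k, continuous_apply k⟩, rfl⟩

/-- The `k`-th axis inclusion `Y k → ∏ Y`, `y ↦ (*, …, *, y, *, …, *)`. -/
def incl {l : ℕ} (Y : Fin l → PtdSpace.{u}) (k : Fin l) : PtdMap (Y k) (PtdSpace.pi Y) :=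
  ⟨⟨fun y => Function.update (PtdSpace.pi Y).pt k y, continuous_const.update k continuous_id⟩,
    Function.update_eq_self k _⟩

/-- The map `X^{n+1} → X^n` forgetting the first coordinate. -/
def powTail (X : PtdSpace.{u}) (n : ℕ) : PtdMap (X.pow (n + 1)) (X.pow n) :=
  ⟨⟨fun x i => x i.succ, continuous_pi fun i => continuous_apply i.succ⟩, rfl⟩

end PtdMap

/-- A pointed homotopy equivalence `A ≃ B`. -/
structure PtdHomotopyEquiv (A : PtdSpace.{u}) (B : PtdSpace.{v}) where
  toMap : PtdMap A B
  invMap : PtdMap B A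
  left_inv : (invMap.comp toMap).Homotopic (PtdMap.id A)
  right_inv : (toMap.comp invMap).Homotopic (PtdMap.id B)

/-- A group-like structure on a pointed space: a multiplication and an inversion satisfying the
group axioms up to pointed homotopy, the base point being the unit. -/
structure PtdGroupLike (X : PtdSpace.{u}) where
  mul : PtdMap (X.prod X) X
  inv : PtdMap X X
  mul_one : (mul.comp (PtdMap.pair (PtdMap.id X) (PtdMap.const X X))).Homotopic (PtdMap.id X)
  one_mul : (mul.comp (PtdMap.pair (PtdMap.const X X) (PtdMap.id X))).Homotopic (PtdMap.id X)
  mul_inv : (mul.comp (PtdMap.pair (PtdMap.id X) inv)).IsNull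
  inv_mul : (mul.comp (PtdMap.pair inv (PtdMap.id X))).IsNull
  mul_assoc :
    let p₁ := (PtdMap.fst X X).comp (PtdMap.fst (X.prod X) X)
    let p₂ := (PtdMap.snd X X).comp (PtdMap.fst (X.prod X) X)
    let p₃ := PtdMap.snd (X.prod X) X
    (mul.comp (PtdMap.pair (mul.comp (PtdMap.pair p₁ p₂)) p₃)).Homotopic
      (mul.comp (PtdMap.pair p₁ (mul.comp (PtdMap.pair p₂ p₃))))

namespace PtdGroupLike

variable {X : PtdSpace.{u}} (G : PtdGroupLike X)

/-- Pointwise product of two maps into `X`. -/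
def pmul {A : PtdSpace.{v}} (f g : PtdMap A X) : PtdMap A X := G.mul.comp (PtdMap.pair f g)

/-- Pointwise product `f 0 · (f 1 · (⋯ ))` of a finite sequence of maps into `X`. -/
def pprod {A : PtdSpace.{v}} : {n : ℕ} → (Fin n → PtdMap A X) → PtdMap A X
  | 0, _ => PtdMap.const A X
  | _ + 1, f => G.pmul (f 0) (pprod fun i => f i.succ)

/-- `α^{±1}`: the map `α` itself, or `α` followed by the inversion of `X`. -/
def sgn {A : PtdSpace.{v}} (s : ℤˣ) (α : PtdMap A X) : PtdMap A X :=
  if s = 1 then α else G.inv.comp α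

/-- The commutator map `γ : X × X → X`, `γ(x, y) = (x y)(x⁻¹ y⁻¹)`. -/
def commutator : PtdMap (X.prod X) X :=
  G.pmul G.mul (G.pmul (G.inv.comp (PtdMap.fst X X)) (G.inv.comp (PtdMap.snd X X)))

/-- The iterated commutator `γ_n : X^{n+1} → X`, with `γ_0 = 1_X` and
`γ_{n+1}(x_0, …, x_{n+1}) = γ(x_0, γ_n(x_1, …, x_{n+1}))`; so `γ_1 = γ`. -/
def iterCommutator : (n : ℕ) → PtdMap (X.pow (n + 1)) X
  | 0 => PtdMap.proj (fun _ : Fin 1 => X) 0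
  | n + 1 => G.commutator.comp (PtdMap.pair (PtdMap.proj (fun _ : Fin (n + 2) => X) 0)
      ((iterCommutator n).comp (PtdMap.powTail X (n + 1))))

/-- The homotopy nilpotency class: the least `n ≥ 1` such that `γ_n` is null homotopic
(`⊤` if there is none). It is `1` exactly if `X` is homotopy commutative. -/
noncomputable def nil : ℕ∞ :=
  ⨅ (n : ℕ) (_ : 1 ≤ n ∧ (G.iterCommutator n).IsNull), (n : ℕ∞)

/-- `γ'` is a reduced commutator map `X ∧ X → X`: composed with the pinching map
`X × X → X ∧ X` it is homotopic to the commutator map. -/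
def IsReducedCommutator (γ' : PtdMap (X.smash X) X) : Prop :=
  (γ'.comp (PtdMap.pinch X X)).Homotopic G.commutator

end PtdGroupLike

/-- The (generalized) Samelson product `⟨α, β⟩ = γ' ∘ (α ∧ β) : A ∧ B → X`, where `γ'` is the
reduced commutator map of `X`. -/
def samelson {X : PtdSpace.{u}} (γ' : PtdMap (X.smash X) X) {A : PtdSpace.{v}} {B : PtdSpace.{w}}
    (α : PtdMap A X) (β : PtdMap B X) : PtdMap (A.smash B) X :=
  γ'.comp (PtdMap.smashMap α β)

/-- The iterated smash product `Y_{j_0} ∧ (Y_{j_1} ∧ (⋯ ∧ Y_{j_n}))`. -/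
def iterSmash {l : ℕ} (Y : Fin l → PtdSpace.{u}) : (n : ℕ) → (Fin (n + 1) → Fin l) → PtdSpace.{u}
  | 0, j => Y (j 0)
  | n + 1, j => (Y (j 0)).smash (iterSmash Y n fun m => j m.succ)

namespace PtdHomotopyEquiv

variable {X : PtdSpace.{u}} {l : ℕ} {Y : Fin l → PtdSpace.{v}}
  (e : PtdHomotopyEquiv X (PtdSpace.pi Y))

/-- The inclusion `ε_k` of the `k`-th factor of a product decomposition of `X`. -/
def factorIncl (k : Fin l) : PtdMap (Y k) X := e.invMap.comp (PtdMap.incl Y k)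

/-- The projection `π_k` onto the `k`-th factor of a product decomposition of `X`. -/
def factorProj (k : Fin l) : PtdMap X (Y k) := (PtdMap.proj Y k).comp e.toMap

/-- The iterated Samelson product
`(ε_{i_0} π_{i_0})^{σ_0} ∘ ⟨ε_{j_0}^{τ_0}, (ε_{i_1} π_{i_1})^{σ_1} ∘ ⟨ ⋯
  (ε_{i_{n-1}} π_{i_{n-1}})^{σ_{n-1}} ∘ ⟨ε_{j_{n-1}}^{τ_{n-1}}, ε_{j_n}^{τ_n}⟩ ⋯ ⟩⟩`. -/
def iterSamelson (G : PtdGroupLike X) (γ' : PtdMap (X.smash X) X) :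
    (n : ℕ) → (i : Fin n → Fin l) → (σ : Fin n → ℤˣ) →
      (j : Fin (n + 1) → Fin l) → (τ : Fin (n + 1) → ℤˣ) → PtdMap (iterSmash Y n j) X
  | 0, _, _, j, τ => G.sgn (τ 0) (e.factorIncl (j 0))
  | n + 1, i, σ, j, τ =>
      (G.sgn (σ 0) ((e.factorIncl (i 0)).comp (e.factorProj (i 0)))).comp
        (samelson γ' (G.sgn (τ 0) (e.factorIncl (j 0)))
          (iterSamelson G γ' n (fun m => i m.succ) (fun m => σ m.succ)
            (fun m => j m.succ) (fun m => τ m.succ)))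

end PtdHomotopyEquiv

-- Let `Γ` be the group `[A, X]` with `A = X^{k+1}`. The class of `γ_k` is the nested commutator of
-- the coordinate projections, so it suffices that `Γ` has nilpotency class at most `k`. Composition
-- with `ε_i π_i` gives operations `φ i` on `Γ`, in general not homomorphisms. The decomposition
-- writes each `x` as the product of the `φ i x`, so a subgroup containing all `φ i x` contains `x`.
-- Pulled back to `A`, the iterated Samelson products become commutators with the `φ i`
-- interspersed, and these vanish by assumption. Shortening these expressions one bracket at a time
-- moves them up the upper central series (`twistedCommutator_mem_upperCentralSeries`), until all of
-- `Γ` lies in its `k`-th term. Subgroups absorb inverses, so positive signs suffice.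

universe t

open scoped commutatorElement

/-! ### Group theory: twisted commutators and the upper central series. -/

section NestedCommutators

variable {Γ : Type*} [Group Γ]

/-- The nested commutator `⁅f 0, ⁅f 1, ⁅⋯, f n⁆⁆⁆`. -/
def nestedCommutator : (n : ℕ) → (Fin (n + 1) → Γ) → Γ
  | 0, f => f 0
  | n + 1, f => ⁅f 0, nestedCommutator n fun m => f m.succ⁆

/-- Each bracket descends one step of the upper central series, starting from `Γ` itself as the
`k`-th term. -/
theorem nestedCommutator_mem_upperCentralSeries {k : ℕ} (n m : ℕ) (h : n + m = k)
    (hΓ : ∀ x : Γ, x ∈ Subgroup.upperCentralSeries Γ k) (f : Fin (n + 1) → Γ) :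
    nestedCommutator n f ∈ Subgroup.upperCentralSeries Γ m := by
  induction n generalizing m with
  | zero => obtain rfl : m = k := by omega
            exact hΓ _
  | succ n ih =>
    have := Subgroup.mem_upperCentralSeries_succ_iff.mp
      (ih (m + 1) (by omega) fun m => f m.succ) (f 0)
    rw [← inv_mem_iff, commutatorElement_inv] at this
    exact this

variable {ι : Type*} (φ : ι → Γ → Γ)

/-- The nested commutator of the elements `φ (j m) (f m)`, in which the operation `φ (i m)` is
applied after the `m`-th commutator. -/
def twistedCommutator : (n : ℕ) → (Fin n → ι) → (Fin (n + 1) → ι) → (Fin (n + 1) → Γ) → Γ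
  | 0, _, j, f => φ (j 0) (f 0)
  | n + 1, i, j, f => φ (i 0) ⁅φ (j 0) (f 0),
      twistedCommutator n (fun m => i m.succ) (fun m => j m.succ) fun m => f m.succ⁆

variable {φ}

/-- Induction on `m`, hence downward on the number `n = k - m` of brackets. Two applications of `hφ`
replace an arbitrary commutator with `s` by a twisted commutator with one more bracket. -/
theorem twistedCommutator_mem_upperCentralSeries
    (hφ : ∀ (H : Subgroup Γ) (x : Γ), (∀ i, φ i x ∈ H) → x ∈ H) {k : ℕ}
    (hk : ∀ i j f, twistedCommutator φ k i j f = 1) (n m : ℕ) (h : n + m = k)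
    (i : Fin n → ι) (j : Fin (n + 1) → ι) (f : Fin (n + 1) → Γ) :
    twistedCommutator φ n i j f ∈ Subgroup.upperCentralSeries Γ m := by
  induction m generalizing n with
  | zero => obtain rfl : n = k := by omega
            simp [hk]
  | succ m ih =>
    set s := twistedCommutator φ n i j f with hs
    rw [Subgroup.mem_upperCentralSeries_succ_iff]
    let q := QuotientGroup.mk' (Subgroup.upperCentralSeries Γ m)
    -- The `y` commuting with `s` modulo the `m`-th term form a subgroup, so `hφ` applies although
    -- the `φ i` need not be multiplicative.
    have key : ∀ y, y ∈ (Subgroup.centralizer {q s}).comap q ↔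
        ⁅s, y⁆ ∈ Subgroup.upperCentralSeries Γ m := by
      intro y
      rw [Subgroup.mem_comap, Subgroup.mem_centralizer_singleton_iff,
        ← QuotientGroup.eq_one_iff, ← QuotientGroup.mk'_apply, map_commutatorElement,
        commutatorElement_eq_one_iff_mul_comm]
      exact eq_comm
    intro y
    rw [← key]
    refine hφ _ _ fun a => ?_
    rw [key, ← inv_mem_iff, commutatorElement_inv]
    -- Here the subgroup is the `m`-th term itself; this supplies the outer operation `φ b`.
    refine hφ _ _ fun b => ?_
    have := ih (n + 1) (by omega) (Fin.cons b i) (Fin.cons a j) (Fin.cons y f)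
    simpa only [twistedCommutator, Fin.cons_zero, Fin.cons_succ] using this

/-- If the twisted commutators of length `k + 1` vanish, and every element lies in the subgroup
generated by its images under the operations, then the nested commutators of length `k + 1`
vanish. -/
theorem nestedCommutator_eq_one
    (hφ : ∀ (H : Subgroup Γ) (x : Γ), (∀ i, φ i x ∈ H) → x ∈ H) {k : ℕ}
    (hk : ∀ i j f, twistedCommutator φ k i j f = 1) (f : Fin (k + 1) → Γ) :
    nestedCommutator k f = 1 := by
  have hΓ : ∀ x : Γ, x ∈ Subgroup.upperCentralSeries Γ k := fun x =>
    -- With no brackets the twisted commutator is just `φ i x`.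
    hφ _ x fun i => twistedCommutator_mem_upperCentralSeries hφ hk 0 k (Nat.zero_add k)
      Fin.elim0 (fun _ => i) (fun _ => x)
  simpa using nestedCommutator_mem_upperCentralSeries k 0 rfl hΓ f

end NestedCommutators

/-! ### Pointed homotopy is a congruence. -/

namespace PtdMap

variable {A : PtdSpace.{u}} {B : PtdSpace.{v}} {C : PtdSpace.{w}}

theorem Homotopic.refl (f : PtdMap A B) : f.Homotopic f :=
  ContinuousMap.HomotopicRel.refl _

theorem Homotopic.symm {f g : PtdMap A B} (h : f.Homotopic g) : g.Homotopic f :=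
  ContinuousMap.HomotopicRel.symm h

theorem Homotopic.trans {f g h : PtdMap A B} (h₁ : f.Homotopic g) (h₂ : g.Homotopic h) :
    f.Homotopic h :=
  ContinuousMap.HomotopicRel.trans h₁ h₂

theorem Homotopic.postcomp {f g : PtdMap A B} (h : f.Homotopic g) (k : PtdMap B C) :
    (k.comp f).Homotopic (k.comp g) :=
  ContinuousMap.HomotopicRel.comp_continuousMap h k.toFun

theorem Homotopic.precomp {f g : PtdMap B C} (h : f.Homotopic g) (k : PtdMap A B) :
    (f.comp k).Homotopic (g.comp k) := by
  obtain ⟨F⟩ := h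
  refine ⟨⟨F.toHomotopy.comp (.refl k.toFun), ?_⟩⟩
  rintro t _ rfl
  exact F.prop t (k.toFun A.pt) k.map_pt

theorem Homotopic.pair {f f' : PtdMap A B} {g g' : PtdMap A C} (h₁ : f.Homotopic f')
    (h₂ : g.Homotopic g') : (pair f g).Homotopic (pair f' g') :=
  Nonempty.map2 ContinuousMap.HomotopyRel.prod h₁ h₂

theorem IsNull.precomp {f : PtdMap B C} (h : f.IsNull) (k : PtdMap A B) : (f.comp k).IsNull :=
  Homotopic.precomp h k

end PtdMap

/-! ### The group `[A, X]` and commutators in it. -/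

/-- The pointed homotopy set `[A, X]`. -/
def PtdHomotopyClass (A : PtdSpace.{v}) (X : PtdSpace.{u}) : Type (max u v) :=
  Quot (PtdMap.Homotopic (A := A) (B := X))

namespace PtdHomotopyClass

variable {A : PtdSpace.{v}} {X : PtdSpace.{u}}

/-- The homotopy class of a pointed map. -/
def cls (f : PtdMap A X) : PtdHomotopyClass A X := Quot.mk _ f

theorem cls_eq_cls {f g : PtdMap A X} : cls f = cls g ↔ f.Homotopic g :=
  Quot.eq.trans (Equivalence.eqvGen_iff
    ⟨PtdMap.Homotopic.refl, PtdMap.Homotopic.symm, PtdMap.Homotopic.trans⟩)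

/-- Composition with a fixed map, as an operation on homotopy classes. -/
def postcomp {Y : PtdSpace.{w}} (θ : PtdMap X Y) : PtdHomotopyClass A X → PtdHomotopyClass A Y :=
  Quot.map (PtdMap.comp θ) fun _ _ h => h.postcomp θ

/-- The group structure of `[A, X]` for a group-like space `X`. -/
abbrev group (G : PtdGroupLike X) (A : PtdSpace.{v}) : Group (PtdHomotopyClass A X) where
  mul := Quot.map₂ G.pmul
    (fun f _ _ h => ((PtdMap.Homotopic.refl f).pair h).postcomp G.mul)
    (fun _ _ f h => (h.pair (PtdMap.Homotopic.refl f)).postcomp G.mul)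
  one := cls (PtdMap.const A X)
  inv := postcomp G.inv
  mul_assoc := by
    rintro ⟨f⟩ ⟨g⟩ ⟨h⟩
    exact cls_eq_cls.2 (G.mul_assoc.precomp (PtdMap.pair (PtdMap.pair f g) h))
  one_mul := by
    rintro ⟨f⟩
    exact cls_eq_cls.2 (G.one_mul.precomp f)
  mul_one := by
    rintro ⟨f⟩
    exact cls_eq_cls.2 (G.mul_one.precomp f)
  inv_mul_cancel := by
    rintro ⟨f⟩
    exact cls_eq_cls.2 (G.inv_mul.precomp f)

variable (G : PtdGroupLike X)

theorem cls_eq_one_iff {f : PtdMap A X} :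
    letI := group G A
    cls f = 1 ↔ f.IsNull :=
  cls_eq_cls

theorem cls_commutator (f g : PtdMap A X) :
    letI := group G A
    cls (G.commutator.comp (PtdMap.pair f g)) = ⁅cls f, cls g⁆ := by
  let := group G A
  rw [commutatorElement_def, mul_assoc]
  rfl

theorem cls_iterCommutator (n : ℕ) (f : PtdMap A (X.pow (n + 1))) :
    letI := group G A
    cls ((G.iterCommutator n).comp f) =
      nestedCommutator n fun m => cls ((PtdMap.proj (fun _ => X) m).comp f) := by
  let := group G A
  induction n with
  | zero => rfl
  | succ n ih =>
    have h := ih ((PtdMap.powTail X (n + 1)).comp f)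
    exact (cls_commutator G ((PtdMap.proj (fun _ : Fin (n + 2) => X) 0).comp f) _).trans (congrArg _ h)

theorem cls_pprod_mem {n : ℕ} (f : Fin n → PtdMap A X) :
    letI := group G A
    ∀ H : Subgroup (PtdHomotopyClass A X), (∀ i, cls (f i) ∈ H) → cls (G.pprod f) ∈ H := by
  let := group G A
  intro H hf
  induction n with
  | zero => exact H.one_mem
  | succ n ih => exact H.mul_mem (hf 0) (ih _ fun i => hf i.succ)

theorem pprod_comp {B : PtdSpace.{w}} {n : ℕ} (f : Fin n → PtdMap A X) (k : PtdMap B A) :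
    (G.pprod f).comp k = G.pprod fun i => (f i).comp k := by
  induction n with
  | zero => rfl
  | succ n ih => exact congrArg (G.pmul ((f 0).comp k)) (ih fun i => f i.succ)

/-- `smashMap α β` after pinching is pinching after `α × β`, and `γ'` after pinching is the
commutator map up to homotopy. -/
theorem cls_samelson {γ' : PtdMap (X.smash X) X} (hγ' : G.IsReducedCommutator γ')
    {D : PtdSpace.{t}} {B : PtdSpace.{w}} (α : PtdMap A X) (β : PtdMap B X)
    (a : PtdMap D A) (b : PtdMap D B) :
    letI := group G D
    cls ((samelson γ' α β).comp ((PtdMap.pinch A B).comp (PtdMap.pair a b))) =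
      ⁅cls (α.comp a), cls (β.comp b)⁆ :=
  (cls_eq_cls.2 (hγ'.precomp (PtdMap.pair (α.comp a) (β.comp b)))).trans (cls_commutator G _ _)

end PtdHomotopyClass

/-! ### Product decompositions and iterated Samelson products. -/

namespace PtdHomotopyEquiv

variable {X : PtdSpace.{u}} {l : ℕ} {Y : Fin l → PtdSpace.{v}}
  (e : PtdHomotopyEquiv X (PtdSpace.pi Y))

/-- The map to the iterated smash product whose coordinates are the projections of given maps
to the factors. -/
def toIterSmash {A : PtdSpace.{w}} : (n : ℕ) → (j : Fin (n + 1) → Fin l) →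
    (Fin (n + 1) → PtdMap A X) → PtdMap A (iterSmash Y n j)
  | 0, j, f => (e.factorProj (j 0)).comp (f 0)
  | n + 1, j, f => (PtdMap.pinch _ _).comp (PtdMap.pair ((e.factorProj (j 0)).comp (f 0))
      (toIterSmash n (fun m => j m.succ) fun m => f m.succ))

/-- The self-map `ε_k π_k` as an operation on `[A, X]`. -/
def factorOp (A : PtdSpace.{w}) (k : Fin l) : PtdHomotopyClass A X → PtdHomotopyClass A X :=
  PtdHomotopyClass.postcomp ((e.factorIncl k).comp (e.factorProj k))

open PtdHomotopyClass

variable (G : PtdGroupLike X)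

/-- The entries `π_j f` of `toIterSmash` meet the `ε_j` of the Samelson product, which creates the
inner operations `ε_j π_j`. -/
theorem cls_iterSamelson_toIterSmash {γ' : PtdMap (X.smash X) X}
    (hγ' : G.IsReducedCommutator γ') {A : PtdSpace.{w}} (n : ℕ) (i : Fin n → Fin l)
    (j : Fin (n + 1) → Fin l) (f : Fin (n + 1) → PtdMap A X) :
    letI := group G A
    cls ((e.iterSamelson G γ' n i (fun _ => 1) j (fun _ => 1)).comp (e.toIterSmash n j f)) =
      twistedCommutator (e.factorOp A) n i j fun m => cls (f m) := by
  let := group G A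
  induction n with
  | zero => rfl
  | succ n ih =>
    have h := ih (fun m => i m.succ) (fun m => j m.succ) (fun m => f m.succ)
    have hs := cls_samelson G hγ' (e.factorIncl (j 0))
      (e.iterSamelson G γ' n (fun m => i m.succ) (fun _ => 1) (fun m => j m.succ) fun _ => 1)
      ((e.factorProj (j 0)).comp (f 0))
      (e.toIterSmash n (fun m => j m.succ) fun m => f m.succ)
    rw [h] at hs
    exact congrArg (e.factorOp A (i 0)) hs

theorem mem_of_factorOp_mem
    (he : (PtdMap.id X).Homotopic (G.pprod fun k => (e.factorIncl k).comp (e.factorProj k)))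
    (A : PtdSpace.{w}) :
    letI := group G A
    ∀ (H : Subgroup (PtdHomotopyClass A X)) (x : PtdHomotopyClass A X),
      (∀ k, e.factorOp A k x ∈ H) → x ∈ H := by
  let := group G A
  rintro H ⟨f⟩ hf
  have h : cls f = cls (G.pprod fun k => ((e.factorIncl k).comp (e.factorProj k)).comp f) := by
    rw [← pprod_comp]
    exact cls_eq_cls.2 (he.precomp f)
  change cls f ∈ H
  rw [h]
  exact cls_pprod_mem G _ H hf

theorem iterCommutator_isNull
    (he : (PtdMap.id X).Homotopic (G.pprod fun k => (e.factorIncl k).comp (e.factorProj k)))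
    {γ' : PtdMap (X.smash X) X} (hγ' : G.IsReducedCommutator γ') {k : ℕ}
    (hS : ∀ (i : Fin k → Fin l) (j : Fin (k + 1) → Fin l),
      (e.iterSamelson G γ' k i (fun _ => 1) j (fun _ => 1)).IsNull) :
    (G.iterCommutator k).IsNull := by
  let := group G (X.pow (k + 1))
  -- The identity of `X^{k+1}` is the universal case: its coordinates are the projections.
  refine (cls_eq_one_iff G).1 ((cls_iterCommutator G k (PtdMap.id _)).trans ?_)
  refine nestedCommutator_eq_one (e.mem_of_factorOp_mem G he _) (fun i j f => ?_) _
  obtain ⟨f, rfl⟩ : ∃ g : Fin (k + 1) → PtdMap (X.pow (k + 1)) X, (fun m => cls (g m)) = f :=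
    ⟨fun m => (f m).out, funext fun m => Quot.out_eq _⟩
  rw [← e.cls_iterSamelson_toIterSmash G hγ']
  exact (cls_eq_one_iff G).2 ((hS i j).precomp _)

end PtdHomotopyEquiv

theorem mainTheorem5
    (X : PtdSpace.{u}) [T2Space X.carrier] [Topology.CWComplex (Set.univ : Set X.carrier)]
    (G : PtdGroupLike X)
    (l : ℕ) (Y : Fin l → PtdSpace.{v}) (e : PtdHomotopyEquiv X (PtdSpace.pi Y))
    (he : (PtdMap.id X).Homotopic (G.pprod fun k => (e.factorIncl k).comp (e.factorProj k)))
    (γ' : PtdMap (X.smash X) X) (hγ' : G.IsReducedCommutator γ')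
    (k : ℕ) (hk : 1 ≤ k)
    (hS : ∀ (i : Fin k → Fin l) (σ : Fin k → ℤˣ) (j : Fin (k + 1) → Fin l) (τ : Fin (k + 1) → ℤˣ),
      (e.iterSamelson G γ' k i σ j τ).IsNull) :
    G.nil ≤ k :=
  iInf₂_le k ⟨hk, e.iterCommutator_isNull G he hγ' fun i j => hS i _ j _⟩
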